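/- \textbf{Bodyguards and Presidents} is played on the vertices of a graph $G$. One player controls a set of tokens, the bodyguards; the other controls a single token, the president. First the bodyguards are placed on vertices (several may share a vertex), then the president is placed on a vertex. Then the players alternate turns, the bodyguards first. In a turn, a player may, for each of his or her tokens, move it to an adjacent vertex or leave it where it is; all positions are visible to both players. The president is \emph{surrounded} if every vertex of the open neighbourhood of his vertex is occupied by a bodyguard. The bodyguards win if the president is surrounded at the end of all but finitely many bodyguard turns; otherwise the president wins. The \emph{bodyguard number} $B(G)$ is the least number of bodyguards that have a winning strategy on $G$. Let $Q_k$ be the $k$-dimensional hypercube: its vertices are the vectors in $\{0,1\}^k$, two of them being adjacent if and only if they differ in exactly one coordinate. \textbf{Theorem.} If $k \ge 3$, then \[ k+1 \;\le\; B(Q_k) \;\le\; \left\lfloor \frac{3k}{2} \right\rfloor . \] -/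

import Mathlib

/-- The `k`-dimensional hypercube: the vertices are the 0/1-vectors of length `k`, and two of them
are adjacent when they differ in exactly one coordinate. -/
def hypercube (k : ℕ) : SimpleGraph (Fin k → Bool) where
  Adj x y := hammingDist x y = 1
  symm := ⟨fun x y h => by rw [hammingDist_comm]; exact h⟩
  loopless := ⟨fun x h => by simp at h⟩

namespace BodyguardsAndPresidents

variable {V : Type*}

/-- A token may move from `x` to `y` in one turn: it stays where it is or moves along an edge. -/
def Step (G : SimpleGraph V) (x y : V) : Prop := x = y ∨ G.Adj x y

/-- A strategy for `m` bodyguards: an initial placement (several bodyguards may share a vertex),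
and a rule which, given the list `h` of all the vertices the president has occupied so far (his
starting vertex first, his current vertex last) and the current placement `b` of the bodyguards,
yields the placement after the bodyguards' next turn. In each turn every bodyguard stays or moves
along an edge. -/
structure Strategy (G : SimpleGraph V) (m : ℕ) where
  start : Fin m → V
  move : List V → (Fin m → V) → (Fin m → V)
  legal : ∀ (h : List V) (b : Fin m → V) (i : Fin m), Step G (b i) (move h b i)

/-- An infinite sequence of legal president positions: he starts on `p 0` (any vertex, chosen after
the bodyguards have been placed), and in each turn he stays or moves along an edge. -/
def IsPresidentPlay (G : SimpleGraph V) (p : ℕ → V) : Prop :=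
  ∀ t : ℕ, Step G (p t) (p (t + 1))

/-- The placement of the bodyguards after `t` bodyguard turns, if they follow the strategy `σ` and
the president plays `p`. The game proceeds as follows: the bodyguards are placed, the president
starts on `p 0`, the bodyguards take their first turn, the president moves to `p 1`, the bodyguards
take their second turn, and so on. So when taking turn number `t + 1` the bodyguards know
`p 0, …, p t`. -/
def Strategy.position {G : SimpleGraph V} {m : ℕ} (σ : Strategy G m) (p : ℕ → V) :
    ℕ → Fin m → V
  | 0 => σ.start
  | t + 1 => σ.move ((List.range (t + 1)).map p) (σ.position p t)

/-- The president on `v` is surrounded by bodyguards placed according to `b`: every vertex of the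
open neighbourhood of `v` is occupied by a bodyguard. -/
def Surrounded (G : SimpleGraph V) {m : ℕ} (b : Fin m → V) (v : V) : Prop :=
  ∀ u : V, G.Adj v u → ∃ i : Fin m, b i = u

/-- The strategy `σ` wins: however the president plays, he is surrounded at the end of all but
finitely many bodyguard turns. At the end of bodyguard turn number `t + 1` he is on `p t`. -/
def Strategy.IsWinning {G : SimpleGraph V} {m : ℕ} (σ : Strategy G m) : Prop :=
  ∀ p : ℕ → V, IsPresidentPlay G p →
    ∃ N : ℕ, ∀ t : ℕ, N ≤ t → Surrounded G (σ.position p (t + 1)) (p t)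

/-- `m` bodyguards suffice to win Bodyguards and Presidents on `G`. -/
def BodyguardsWin (G : SimpleGraph V) (m : ℕ) : Prop :=
  ∃ σ : Strategy G m, σ.IsWinning

/-- The bodyguard number `B(G)`: the least number of bodyguards that suffice to win on `G`
(`⊤` if no finite number suffices). -/
noncomputable def bodyguardNumber (G : SimpleGraph V) : ℕ∞ :=
  ⨅ (m : ℕ) (_ : BodyguardsWin G m), (m : ℕ∞)

end BodyguardsAndPresidents

/-! Lower bound: surrounding takes `k` adjacent bodyguards on distinct vertices, so among at most
`k` of them none can be dispensed with. As `k ≥ 3`, the president can keep one chosen bodyguard at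
distance at least two forever. Upper bound: record each bodyguard by the set `D i` of coordinates in
which he differs from the president. By imitating the president's moves the bodyguards keep all `D
i` fixed, so a surrounded president stays surrounded. Until then the lexicographic `potential` can
be lowered each turn. With `k` bodyguards at distance at most one, a spare one among them helps to
fill a gap (`exists_answer_of_le_card_close`). Otherwise more than `k / 2` are far, and one of them
either gets closer or makes a new coordinate watched (`exists_answer_of_lt_card_far`). -/

open scoped symmDiff

namespace BodyguardsAndPresidents

/-! ### Invariants for the president, potentials for the bodyguards -/

section General

variable {V : Type*} {G : SimpleGraph V} {m : ℕ}

/-- If the president can maintain an invariant of the placements at the end of the bodyguards'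
turns, then he has a play along which it always holds. -/
theorem Strategy.exists_play (σ : Strategy G m) (P : (Fin m → V) → V → Prop)
    (h0 : ∃ v, ∀ h, P (σ.move h σ.start) v)
    (hs : ∀ b v, P b v → ∃ w, Step G v w ∧ ∀ h, P (σ.move h b) w) :
    ∃ p, IsPresidentPlay G p ∧ ∀ t, P (σ.position p (t + 1)) (p t) := by
  classical
  obtain ⟨v₀, hv₀⟩ := h0
  choose! f hf using hs
  -- The state holds the history, the placement after the bodyguards' answer, and the president's
  -- vertex.
  let s : ℕ → List V × (Fin m → V) × V := fun t =>
    Nat.rec ([v₀], σ.move [v₀] σ.start, v₀)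
      (fun _ s => (s.1 ++ [f s.2.1 s.2.2], σ.move (s.1 ++ [f s.2.1 s.2.2]) s.2.1,
        f s.2.1 s.2.2)) t
  let p : ℕ → V := fun t => (s t).2.2
  have hsucc : ∀ t, s (t + 1) = ((s t).1 ++ [f (s t).2.1 (s t).2.2],
      σ.move ((s t).1 ++ [f (s t).2.1 (s t).2.2]) (s t).2.1, f (s t).2.1 (s t).2.2) :=
    fun _ => rfl
  have hp : ∀ t, p (t + 1) = f (s t).2.1 (s t).2.2 := fun _ => rfl
  have key : ∀ t, (s t).1 = (List.range (t + 1)).map p ∧ (s t).2.1 = σ.position p (t + 1) := by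
    intro t
    induction t with
    | zero => exact ⟨rfl, rfl⟩
    | succ t ih =>
      have h1 : (s (t + 1)).1 = (List.range (t + 2)).map p := by
        rw [List.range_succ, List.map_append, ← ih.1, hsucc]
        rfl
      refine ⟨h1, ?_⟩
      change _ = σ.move ((List.range (t + 2)).map p) (σ.position p (t + 1))
      rw [← h1, ← ih.2, hsucc]
  have hP : ∀ t, P (s t).2.1 (p t) := by
    intro t
    induction t with
    | zero => exact hv₀ _
    | succ t ih =>
      rw [hp, hsucc]
      exact (hf _ _ ih).2 _
  refine ⟨p, fun t => ?_, fun t => (key t).2 ▸ hP t⟩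
  rw [hp]
  exact (hf _ _ (hP t)).1

/-- The bodyguards win if they can always answer the president's move so that a well-founded
potential drops, until he is surrounded, and if they can keep him surrounded from then on. -/
theorem bodyguardsWin_of_potential [Nonempty V] {α : Type*} [Preorder α] [WellFoundedLT α]
    (μ : (Fin m → V) → V → α)
    (H : ∀ b v w, Step G v w → ∃ b' : Fin m → V, (∀ i, Step G (b i) (b' i)) ∧
      (Surrounded G b v → Surrounded G b' w) ∧
      (¬ Surrounded G b v → Surrounded G b' w ∨ μ b' w < μ b v)) :
    BodyguardsWin G m := by
  classical
  have H' : ∀ b v w, ∃ b' : Fin m → V, (∀ i, Step G (b i) (b' i)) ∧ (Step G v w →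
      (Surrounded G b v → Surrounded G b' w) ∧
      (¬ Surrounded G b v → Surrounded G b' w ∨ μ b' w < μ b v)) := by
    intro b v w
    by_cases h : Step G v w
    · obtain ⟨b', h1, h2⟩ := H b v w h
      exact ⟨b', h1, fun _ => h2⟩
    · exact ⟨b, fun i => Or.inl rfl, fun h' => absurd h' h⟩
  choose f hf hf' using H'
  let v₀ : V := Classical.arbitrary V
  let σ : Strategy G m :=
    { start := fun _ => v₀
      -- On the first turn there is no previous vertex and `v₀` stands in. That move is legal but
      -- otherwise arbitrary; the potential is tracked only from the second turn on.
      move := fun h b => f b ((h.dropLast).getLast?.getD v₀) (h.getLast?.getD v₀)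
      legal := fun h b i => hf _ _ _ i }
  refine ⟨σ, fun p hp => ?_⟩
  have hpos : ∀ t, σ.position p (t + 2) = f (σ.position p (t + 1)) (p t) (p (t + 1)) := by
    intro t
    change σ.move ((List.range (t + 2)).map p) (σ.position p (t + 1)) = _
    simp [σ, List.range_succ]
  have hstep : ∀ t, (Surrounded G (σ.position p (t + 1)) (p t) →
        Surrounded G (σ.position p (t + 2)) (p (t + 1))) ∧
      (¬ Surrounded G (σ.position p (t + 1)) (p t) →
        Surrounded G (σ.position p (t + 2)) (p (t + 1)) ∨
          μ (σ.position p (t + 2)) (p (t + 1)) < μ (σ.position p (t + 1)) (p t)) := by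
    intro t
    rw [hpos]
    exact hf' _ _ _ (hp t)
  have hex : ∀ a : α, ∀ t, μ (σ.position p (t + 1)) (p t) = a →
      ∃ N, Surrounded G (σ.position p (N + 1)) (p N) := by
    intro a
    induction a using WellFoundedLT.induction with
    | ind a ih =>
      intro t ht
      by_cases hS : Surrounded G (σ.position p (t + 1)) (p t)
      · exact ⟨t, hS⟩
      · rcases (hstep t).2 hS with h | h
        · exact ⟨_, h⟩
        · exact ih _ (ht ▸ h) (t + 1) rfl
  obtain ⟨N, hN⟩ := hex _ 0 rfl
  refine ⟨N, fun t ht => ?_⟩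
  induction t, ht using Nat.le_induction with
  | base => exact hN
  | succ t _ ih => exact (hstep t).1 ih

end General

/-! ### Difference sets in the hypercube -/

section Cube

variable {k m : ℕ}

/-- The set of the coordinates in which two vertices of the cube differ. -/
def diffSet (x y : Fin k → Bool) : Finset (Fin k) := Finset.univ.filter fun j => x j ≠ y j

theorem card_diffSet (x y : Fin k → Bool) : (diffSet x y).card = hammingDist x y := rfl

theorem mem_diffSet {x y : Fin k → Bool} {j : Fin k} : j ∈ diffSet x y ↔ x j ≠ y j := by
  simp [diffSet]

/-- The vertex that differs from `x` exactly in the coordinates in `A`. -/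
def flip (x : Fin k → Bool) (A : Finset (Fin k)) : Fin k → Bool :=
  fun j => xor (x j) (decide (j ∈ A))

theorem diffSet_flip_left (x : Fin k → Bool) (A : Finset (Fin k)) : diffSet (flip x A) x = A := by
  ext j
  simp only [mem_diffSet, flip]
  by_cases h : j ∈ A <;> simp [h]

theorem diffSet_comm (x y : Fin k → Bool) : diffSet x y = diffSet y x := by
  ext j
  simp only [mem_diffSet, ne_comm]

theorem diffSet_symmDiff (x y z : Fin k → Bool) :
    diffSet x y ∆ diffSet y z = diffSet x z := by
  ext j
  simp only [Finset.mem_symmDiff, mem_diffSet]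
  cases x j <;> cases y j <;> cases z j <;> simp

theorem diffSet_left_injective (y : Fin k → Bool) :
    Function.Injective fun x => diffSet x y := by
  intro x x' h
  funext j
  have := congrArg (j ∈ ·) h
  simp only [mem_diffSet] at this
  cases hx : x j <;> cases hx' : x' j <;> cases hy : y j <;> simp_all

theorem step_hypercube_iff {x y : Fin k → Bool} :
    Step (hypercube k) x y ↔ (diffSet x y).card ≤ 1 := by
  rw [card_diffSet]
  change x = y ∨ hammingDist x y = 1 ↔ _
  rw [← hammingDist_eq_zero]
  omega

theorem surrounded_hypercube_iff {b : Fin m → Fin k → Bool} {v : Fin k → Bool} :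
    Surrounded (hypercube k) b v ↔ ∀ j, ∃ i, diffSet (b i) v = {j} := by
  constructor
  · intro h j
    obtain ⟨i, hi⟩ := h (flip v {j}) (by
      change hammingDist _ _ = 1
      rw [← card_diffSet, diffSet_comm, diffSet_flip_left, Finset.card_singleton])
    exact ⟨i, by rw [hi, diffSet_flip_left]⟩
  · intro h u hu
    obtain ⟨j, hj⟩ := Finset.card_eq_one.1 ((card_diffSet v u).trans hu)
    obtain ⟨i, hi⟩ := h j
    exact ⟨i, diffSet_left_injective v (by simp only [hi, diffSet_comm u v, hj])⟩

/-! ### Lower bound: evading bodyguard `0` -/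

theorem le_card_of_bodyguardsWin (hk : 3 ≤ k) (h : BodyguardsWin (hypercube k) m) :
    k + 1 ≤ m := by
  obtain ⟨σ, hσ⟩ := h
  by_contra! hm
  have hstep : ∀ {x y v : Fin k → Bool}, Step (hypercube k) x y →
      3 ≤ (diffSet x v).card → 2 ≤ (diffSet y v).card := by
    intro x y v hxy h3
    rw [step_hypercube_iff, card_diffSet] at hxy
    rw [card_diffSet] at h3 ⊢
    have := hammingDist_triangle x y v
    omega
  obtain ⟨p, hp, hP⟩ := σ.exists_play
    (fun b v => ∀ i : Fin m, i.val = 0 → 2 ≤ (diffSet (b i) v).card)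
    (by
      by_cases hm0 : m = 0
      · subst hm0
        exact ⟨fun _ => true, fun _ i => i.elim0⟩
      -- Start at the antipode of bodyguard `0`, at distance `k ≥ 3`.
      refine ⟨flip (σ.start ⟨0, by omega⟩) Finset.univ, fun h i hi => ?_⟩
      rw [show i = ⟨0, Nat.pos_of_ne_zero hm0⟩ from Fin.ext hi]
      refine hstep (σ.legal h _ _) ?_
      rw [diffSet_comm, diffSet_flip_left]
      simpa using hk)
    (by
      intro b v hbv
      by_cases hm0 : m = 0
      · subst hm0
        exact ⟨v, Or.inl rfl, fun _ i => i.elim0⟩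
      suffices h : ∃ w, Step (hypercube k) v w ∧ 3 ≤ (diffSet (b ⟨0, by omega⟩) w).card by
        obtain ⟨w, hw, h3⟩ := h
        refine ⟨w, hw, fun h i hi => ?_⟩
        rw [show i = ⟨0, Nat.pos_of_ne_zero hm0⟩ from Fin.ext hi]
        exact hstep (σ.legal h _ _) h3
      have h2 := hbv ⟨0, by omega⟩ rfl
      by_cases h3 : 3 ≤ (diffSet (b ⟨0, by omega⟩) v).card
      · exact ⟨v, Or.inl rfl, h3⟩
      -- At distance two, below `k`, some coordinate still agrees; flipping it restores distance
      -- three.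
      obtain ⟨j, hj⟩ : ∃ j, j ∉ diffSet (b ⟨0, by omega⟩) v := by
        by_contra! hall
        rw [Finset.eq_univ_iff_forall.2 hall, Finset.card_univ, Fintype.card_fin] at h3
        exact h3 hk
      refine ⟨flip v {j}, ?_, ?_⟩
      · rw [step_hypercube_iff, diffSet_comm, diffSet_flip_left, Finset.card_singleton]
      · rw [← diffSet_symmDiff _ v, diffSet_comm v, diffSet_flip_left,
          Finset.symmDiff_eq_union (by simpa using hj),
          Finset.card_union_of_disjoint (by simpa using hj), Finset.card_singleton]
        omega)
  obtain ⟨N, hN⟩ := hσ p hp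
  have hS := surrounded_hypercube_iff.1 (hN N le_rfl)
  choose g hg using hS
  have hinj : Function.Injective g := fun a a' haa => by
    have := (hg a).symm.trans (haa ▸ hg a')
    exact Finset.singleton_injective this
  have hkm : k ≤ m := by simpa using Fintype.card_le_of_injective g hinj
  obtain rfl : m = k := by omega
  obtain ⟨j, hj⟩ := Finite.surjective_of_injective hinj ⟨0, by omega⟩
  have := hP N (g j) (by rw [hj])
  rw [hg, Finset.card_singleton] at this
  omega

/-! ### Upper bound: relative positions and the potential -/

/-- The total number of coordinates by which the bodyguards fail to be close to the president. -/
def totalExcess (D : Fin m → Finset (Fin k)) : ℕ := ∑ i, ((D i).card - 1)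

/-- The neighbours of the president, given by a coordinate, that no bodyguard occupies. -/
def unoccupied (D : Fin m → Finset (Fin k)) : Finset (Fin k) :=
  Finset.univ.filter fun j => ∀ i, D i ≠ {j}

/-- The coordinates in which no bodyguard at distance at least two differs from the president. -/
def unwatched (D : Fin m → Finset (Fin k)) : Finset (Fin k) :=
  Finset.univ.filter fun j => ∀ i, 2 ≤ (D i).card → j ∉ D i

/-- The potential of a placement relative to the president. -/
def potential (D : Fin m → Finset (Fin k)) : ℕ ×ₗ ℕ ×ₗ ℕ ×ₗ ℕ :=
  toLex (totalExcess D, toLex ((unoccupied D).card,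
    toLex (∑ i, (D i).card, (unwatched D).card)))

theorem potential_lt_iff {D D' : Fin m → Finset (Fin k)} :
    potential D' < potential D ↔ totalExcess D' < totalExcess D ∨
      totalExcess D' = totalExcess D ∧ ((unoccupied D').card < (unoccupied D).card ∨
        (unoccupied D').card = (unoccupied D).card ∧ (∑ i, (D' i).card < ∑ i, (D i).card ∨
          ∑ i, (D' i).card = ∑ i, (D i).card ∧ (unwatched D').card < (unwatched D).card)) := by
  simp [potential, Prod.Lex.toLex_lt_toLex]

/-- A legal answer of the bodyguards, in positions relative to the president, after he has changed
the coordinates in `X`. -/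
def IsAnswer (X : Finset (Fin k)) (D D' : Fin m → Finset (Fin k)) : Prop :=
  ∀ i, (D i ∆ X ∆ D' i).card ≤ 1

/-- Every bodyguard imitates the president's move. The other answers alter this one for one or two
bodyguards. -/
theorem isAnswer_self {X : Finset (Fin k)} (hX : X.card ≤ 1) (D : Fin m → Finset (Fin k)) :
    IsAnswer X D D := fun i => by
  rwa [symmDiff_comm (D i), symmDiff_symmDiff_cancel_right]

theorem IsAnswer.update {X : Finset (Fin k)} {D D' : Fin m → Finset (Fin k)}
    (h : IsAnswer X D D') (g : Fin m) (A : Finset (Fin k)) (hA : (D g ∆ X ∆ A).card ≤ 1) :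
    IsAnswer X D (Function.update D' g A) := fun i => by
  rcases eq_or_ne i g with rfl | hi
  · simpa using hA
  · simpa [hi] using h i

theorem totalExcess_update_of_card_le {D : Fin m → Finset (Fin k)} {g : Fin m}
    {A : Finset (Fin k)} (hg : (D g).card ≤ 1) (hA : A.card ≤ 1) :
    totalExcess (Function.update D g A) = totalExcess D := by
  refine Finset.sum_congr rfl fun i _ => ?_
  rcases eq_or_ne i g with rfl | hi
  · simp; omega
  · simp [hi]

theorem totalExcess_update_lt {D : Fin m → Finset (Fin k)} {g : Fin m}
    {A : Finset (Fin k)} (hA : A.card < (D g).card) (hg : 2 ≤ (D g).card) :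
    totalExcess (Function.update D g A) < totalExcess D := by
  refine Finset.sum_lt_sum (fun i _ => ?_) ⟨g, Finset.mem_univ _, ?_⟩
  · rcases eq_or_ne i g with rfl | hi
    · simp; omega
    · simp [hi]
  · simp; omega

/-- If at least `k` bodyguards are close to the president, but he is not surrounded, then they have
an answer that drops the potential. -/
theorem exists_answer_of_le_card_close {D : Fin m → Finset (Fin k)} {X : Finset (Fin k)}
    (hX : X.card ≤ 1) {u : Fin k} (hu : ∀ i, D i ≠ {u})
    (hclose : k ≤ (Finset.univ.filter fun i => (D i).card ≤ 1).card) :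
    ∃ D', IsAnswer X D D' ∧ potential D' < potential D := by
  -- A spare bodyguard `s`, on the president or sharing a neighbour. Otherwise the `k` close ones
  -- would occupy distinct neighbours, all different from `u`.
  obtain ⟨s, hs, hdup⟩ : ∃ s, (D s).card ≤ 1 ∧ ∀ j, D s = {j} → ∃ g, g ≠ s ∧ D g = {j} := by
    by_contra! hno
    have hne : ∀ i, (D i).card ≤ 1 → ∃ j, D i = {j} := fun i hi =>
      (hno i hi).imp fun j hj => hj.1
    have : Nonempty (Fin k) := ⟨u⟩
    choose! f hf using hne
    have hlt : (Finset.univ.erase u).card <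
        (Finset.univ.filter fun i => (D i).card ≤ 1).card := by
      rw [Finset.card_erase_of_mem (Finset.mem_univ _), Finset.card_univ, Fintype.card_fin]
      have := u.pos
      omega
    obtain ⟨g, hg, g', hg', hgg, hfg⟩ := Finset.exists_ne_map_eq_of_card_lt_of_maps_to hlt
      (f := f) (fun i hi => by
        have hi := hf i (by simpa using hi)
        simp only [Finset.coe_erase, Finset.coe_univ, Set.mem_sdiff, Set.mem_univ,
          Set.mem_singleton_iff, true_and]
        rintro h
        exact hu i (h ▸ hi))
    have hg := (Finset.mem_filter.1 hg).2
    have hg' := (Finset.mem_filter.1 hg').2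
    obtain ⟨j, hj, hj'⟩ := hno g hg
    exact hj' g' hgg.symm (by rw [hf g' hg', ← hfg, ← hf g hg, hj])
  have hlt : ∀ {D' : Fin m → Finset (Fin k)} {u' : Fin k}, (∀ i, D i ≠ {u'}) →
      (∃ i, D' i = {u'}) → (∀ j i, D i = {j} → ∃ i', D' i' = {j}) →
      totalExcess D' = totalExcess D → potential D' < potential D := by
    intro D' u' hu' hu'' hsub hW
    refine potential_lt_iff.2 (Or.inr ⟨hW, Or.inl (Finset.card_lt_card ?_)⟩)
    rw [Finset.ssubset_iff_of_subset]
    · exact ⟨u', by simpa [unoccupied] using hu', by simpa [unoccupied] using hu''⟩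
    · intro j hj
      simp only [unoccupied, Finset.mem_filter, Finset.mem_univ, true_and] at hj ⊢
      intro i hi
      obtain ⟨i', hi'⟩ := hsub j i hi
      exact hj i' hi'
  have hkeep : ∀ A, ∀ j i, D i = {j} → ∃ i', Function.update D s A i' = {j} := by
    intro A j i hi
    rcases eq_or_ne i s with rfl | his
    · obtain ⟨g, hgs, hg⟩ := hdup j hi
      exact ⟨g, by simpa [hgs] using hg⟩
    · exact ⟨i, by simpa [his] using hi⟩
  rcases Nat.le_one_iff_eq_zero_or_eq_one.1 hX with h0 | h1
  · obtain rfl := Finset.card_eq_zero.1 h0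
    rcases Nat.le_one_iff_eq_zero_or_eq_one.1 hs with hs0 | hs1
    · have hs0' := Finset.card_eq_zero.1 hs0
      refine ⟨_, (isAnswer_self hX D).update s {u} ?_, hlt hu ⟨s, by simp⟩ (hkeep _)
        (totalExcess_update_of_card_le hs (by simp))⟩
      rw [hs0', ← Finset.bot_eq_empty, symmDiff_self, bot_symmDiff, Finset.card_singleton]
    -- If the president rests, `s` first steps onto him; only the third component of the potential
    -- is sure to fall.
    · refine ⟨_, (isAnswer_self hX D).update s ∅ ?_, potential_lt_iff.2 (Or.inr
        ⟨totalExcess_update_of_card_le hs (by simp), ?_⟩)⟩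
      · rw [← Finset.bot_eq_empty, symmDiff_bot, symmDiff_bot, hs1]
      · have hle : (unoccupied (Function.update D s ∅)).card ≤ (unoccupied D).card := by
          refine Finset.card_le_card fun j hj => ?_
          simp only [unoccupied, Finset.mem_filter, Finset.mem_univ, true_and] at hj ⊢
          intro i hi
          obtain ⟨i', hi'⟩ := hkeep ∅ j i hi
          exact hj i' hi'
        rcases hle.lt_or_eq with h | h
        · exact Or.inl h
        · refine Or.inr ⟨h, Or.inl (Finset.sum_lt_sum (fun i _ => ?_) ⟨s, Finset.mem_univ _, ?_⟩)⟩
          · rcases eq_or_ne i s with rfl | his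
            · simp
            · simp [his]
          · simp [hs1]
  · obtain ⟨i, rfl⟩ := Finset.card_eq_one.1 h1
    by_cases hsi : D s = {i}
    · refine ⟨_, (isAnswer_self hX D).update s {u} ?_, hlt hu ⟨s, by simp⟩ (hkeep _)
        (totalExcess_update_of_card_le hs (by simp))⟩
      rw [hsi, symmDiff_self, bot_symmDiff, Finset.card_singleton]
    have hA : (D s ∆ {i} ∆ {i}).card ≤ 1 := by rwa [symmDiff_symmDiff_cancel_right]
    -- The president may have moved onto a bodyguard `h`, who can then go on to `u` while `s` takes
    -- over the place `{i}`. If there is no such `h`, then `i` itself is a gap that `s` fills.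
    by_cases hh : ∃ h, D h = {i}
    · obtain ⟨h, hh⟩ := hh
      have hne : h ≠ s := by rintro rfl; exact hsi hh
      refine ⟨Function.update (Function.update D s {i}) h {u},
        ((isAnswer_self hX D).update s {i} hA).update h {u} ?_,
        hlt hu ⟨h, by simp⟩ ?_ ?_⟩
      · rw [hh, symmDiff_self, bot_symmDiff, Finset.card_singleton]
      · intro j g hg
        by_cases hj : j = i
        · subst hj
          exact ⟨s, by simp [hne.symm]⟩
        · obtain ⟨g', hg'⟩ := hkeep {i} j g hg
          have hgh : g' ≠ h := by
            rintro rfl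
            rw [Function.update_of_ne hne, hh] at hg'
            exact hj (Finset.singleton_injective hg').symm
          exact ⟨g', by rw [Function.update_of_ne hgh, hg']⟩
      · rw [totalExcess_update_of_card_le (by simp [hne, hh]) (by simp),
          totalExcess_update_of_card_le hs (by simp)]
    · exact ⟨_, (isAnswer_self hX D).update s {i} hA, hlt (not_exists.1 hh) ⟨s, by simp⟩ (hkeep _)
        (totalExcess_update_of_card_le hs (by simp))⟩

/-- If more than half as many bodyguards as there are coordinates are at distance at least two from
the president, then the bodyguards have an answer that drops the potential. -/
theorem exists_answer_of_lt_card_far {D : Fin m → Finset (Fin k)} {X : Finset (Fin k)}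
    (hX : X.card ≤ 1)
    (hfar : k < 2 * (Finset.univ.filter fun i => 2 ≤ (D i).card).card) :
    ∃ D', IsAnswer X D D' ∧ potential D' < potential D := by
  set H := Finset.univ.filter fun i => 2 ≤ (D i).card with hH
  have memH : ∀ {i}, i ∈ H ↔ 2 ≤ (D i).card := by simp [hH]
  rcases Nat.le_one_iff_eq_zero_or_eq_one.1 hX with h0 | h1
  · obtain rfl := Finset.card_eq_zero.1 h0
    obtain ⟨g, hg⟩ : H.Nonempty := by
      rw [← Finset.card_pos]; omega
    obtain ⟨j, hj⟩ : (D g).Nonempty := by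
      rw [← Finset.card_pos]; have := memH.1 hg; omega
    refine ⟨_, (isAnswer_self hX D).update g ((D g).erase j) ?_,
      potential_lt_iff.2 (Or.inl (totalExcess_update_lt (Finset.card_erase_lt_of_mem hj)
        (memH.1 hg)))⟩
    refine (Finset.card_le_card (t := {j}) fun a ha => ?_).trans (by simp)
    simp only [Finset.mem_symmDiff, Finset.mem_erase, Finset.notMem_empty] at ha
    simp only [Finset.mem_singleton]
    tauto
  · obtain ⟨i, rfl⟩ := Finset.card_eq_one.1 h1
    by_cases hi : ∃ g ∈ H, i ∈ D g
    · obtain ⟨g, hg, hi⟩ := hi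
      refine ⟨_, (isAnswer_self hX D).update g ((D g).erase i) ?_,
        potential_lt_iff.2 (Or.inl (totalExcess_update_lt (Finset.card_erase_lt_of_mem hi)
          (memH.1 hg)))⟩
      refine (Finset.card_le_card (t := {i}) fun a ha => ?_).trans (by simp)
      simp only [Finset.mem_symmDiff, Finset.mem_erase, Finset.mem_singleton] at ha
      simp only [Finset.mem_singleton]
      tauto
    · push Not at hi
      -- Pairwise disjoint sets of size at least two would need more than `k` coordinates.
      obtain ⟨g, hg, g', hg', hne, j, hj, hj'⟩ :
          ∃ g ∈ H, ∃ g' ∈ H, g ≠ g' ∧ ∃ j, j ∈ D g ∧ j ∈ D g' := by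
        by_contra! hno
        have hdisj : (H : Set (Fin m)).PairwiseDisjoint D := fun g hg g' hg' hne =>
          Finset.disjoint_left.2 fun j hj => hno g hg g' hg' hne j hj
        have h2 : H.card * 2 ≤ ∑ g ∈ H, (D g).card :=
          Finset.card_nsmul_le_sum H _ 2 fun g hg => memH.1 hg
        rw [← Finset.card_biUnion hdisj] at h2
        have h3 := Finset.card_le_univ (H.biUnion D)
        rw [Fintype.card_fin] at h3
        omega
      -- Bodyguard `g` trades `j` for `i`: `j` stays watched by `g'`, while `i` becomes watched.
      have hij : i ≠ j := by rintro rfl; exact hi g hg hj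
      have hcard : (insert i ((D g).erase j)).card = (D g).card := by
        rw [Finset.card_insert_of_notMem (fun h => hi g hg (Finset.mem_of_mem_erase h)),
          Finset.card_erase_add_one hj]
      have hcards : ∀ a, (Function.update D g (insert i ((D g).erase j)) a).card
          = (D a).card := by
        intro a
        rcases eq_or_ne a g with rfl | ha
        · simpa using hcard
        · simp [ha]
      refine ⟨_, (isAnswer_self hX D).update g (insert i ((D g).erase j)) ?_,
        potential_lt_iff.2 (Or.inr ⟨?_, ?_⟩)⟩
      · refine (Finset.card_le_card (t := {j}) fun a ha => ?_).trans (by simp)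
        simp only [Finset.mem_symmDiff, Finset.mem_erase, Finset.mem_singleton,
          Finset.mem_insert] at ha
        simp only [Finset.mem_singleton]
        by_cases hai : a = i
        · subst hai
          have := hi g hg
          tauto
        · tauto
      · exact Finset.sum_congr rfl fun a _ => by rw [hcards]
      · refine Or.inr ⟨congrArg Finset.card ?_, Or.inr
          ⟨Finset.sum_congr rfl fun a _ => hcards a, Finset.card_lt_card ?_⟩⟩
        · refine Finset.filter_congr fun l _ => forall_congr' fun a => not_congr ?_
          rcases eq_or_ne a g with rfl | ha
          · have h2 := memH.1 hg
            constructor <;> intro h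
            · have := hcards a
              rw [h, Finset.card_singleton] at this
              omega
            · rw [h, Finset.card_singleton] at h2
              omega
          · simp [ha]
        · rw [Finset.ssubset_iff_of_subset]
          · refine ⟨i, ?_, ?_⟩
            · simp only [unwatched, Finset.mem_filter, Finset.mem_univ, true_and]
              exact fun a ha => hi a (memH.2 ha)
            · simp only [unwatched, Finset.mem_filter, Finset.mem_univ, true_and]
              intro h
              exact h g (by rw [hcards]; exact memH.1 hg) (by simp)
          · intro l hl
            simp only [unwatched, Finset.mem_filter, Finset.mem_univ, true_and, hcards] at hl ⊢
            intro a ha hla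
            rcases eq_or_ne a g with rfl | hag
            · by_cases hlj : l = j
              · subst hlj
                exact hl g' (memH.1 hg') (by simpa [hne.symm] using hj')
              · exact hl a ha (by simp [hlj, hla])
            · exact hl a ha (by simpa [hag] using hla)

theorem bodyguardsWin_hypercube (k : ℕ) : BodyguardsWin (hypercube k) (3 * k / 2) := by
  refine bodyguardsWin_of_potential (fun b v => potential fun i => diffSet (b i) v) ?_
  intro b v w hvw
  rw [step_hypercube_iff] at hvw
  obtain ⟨D', hD', h1, h2⟩ : ∃ D', IsAnswer (diffSet v w) (fun i => diffSet (b i) v) D' ∧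
      (Surrounded (hypercube k) b v → D' = fun i => diffSet (b i) v) ∧
      (¬ Surrounded (hypercube k) b v →
        potential D' < potential fun i => diffSet (b i) v) := by
    by_cases hS : Surrounded (hypercube k) b v
    · exact ⟨_, isAnswer_self hvw _, fun _ => rfl, fun h => absurd hS h⟩
    suffices h : ∃ D', IsAnswer (diffSet v w) (fun i => diffSet (b i) v) D' ∧
        potential D' < potential fun i => diffSet (b i) v by
      obtain ⟨D', hD', h⟩ := h
      exact ⟨D', hD', fun h' => absurd h' hS, fun _ => h⟩
    by_cases hc : k ≤ (Finset.univ.filter fun i => (diffSet (b i) v).card ≤ 1).card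
    · rw [surrounded_hypercube_iff] at hS
      push Not at hS
      obtain ⟨u, hu⟩ := hS
      exact exists_answer_of_le_card_close hvw hu hc
    -- At most `k - 1` bodyguards are close, so at least `3 * k / 2 - (k - 1) > k / 2` are far.
    · refine exists_answer_of_lt_card_far hvw ?_
      have := Finset.card_filter_add_card_filter_not (s := Finset.univ)
        (fun i => (diffSet (b i) v).card ≤ 1)
      simp only [not_le, Finset.card_univ, Fintype.card_fin] at this
      change k < 2 * (Finset.univ.filter fun i => 1 < (diffSet (b i) v).card).card
      omega
  have hflip : (fun i => diffSet (flip w (D' i)) w) = D' :=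
    funext fun i => diffSet_flip_left w (D' i)
  refine ⟨fun i => flip w (D' i), fun i => ?_, fun hS => ?_, fun hS => Or.inr ?_⟩
  · rw [step_hypercube_iff, ← diffSet_symmDiff _ w, ← diffSet_symmDiff _ v w,
      diffSet_comm w, diffSet_flip_left]
    exact hD' i
  · rw [surrounded_hypercube_iff] at hS ⊢
    intro j
    simpa only [diffSet_flip_left, h1 (surrounded_hypercube_iff.2 hS)] using hS j
  · simpa only [hflip] using h2 hS

end Cube

end BodyguardsAndPresidents

theorem mainTheorem11 (k : ℕ) (hk : 3 ≤ k) :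
    ((k + 1 : ℕ) : ℕ∞) ≤ BodyguardsAndPresidents.bodyguardNumber (hypercube k) ∧
      BodyguardsAndPresidents.bodyguardNumber (hypercube k) ≤ ((3 * k / 2 : ℕ) : ℕ∞) := by
  constructor
  · exact le_iInf₂ fun m hm =>
      Nat.cast_le.2 (BodyguardsAndPresidents.le_card_of_bodyguardsWin hk hm)
  · exact iInf₂_le _ (BodyguardsAndPresidents.bodyguardsWin_hypercube k)
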